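/- Let $X$, $Y$, $Z$ be Banach spaces over the same field $\mathbb{K}\in\{\mathbb{R},\mathbb{C}\}$, let $1\le p\le\infty$ and let $p'$ be the conjugate index ($1/p+1/p'=1$, with $1/\infty=0$). Notation. For a finite or infinite family $(x_i)$ of vectors of a Banach space $E$ and $1\le q\le\infty$, let $\|(x_i)\|_q$ be its $\ell_q$-norm and $\|(x_i)\|_q^w=\sup\{\|(\varphi(x_i))\|_q : \varphi\in E^*,\ \|\varphi\|\le 1\}$. A sequence $(x_i)$ in $E$ belongs to $\ell_q^w(E)$ if $(\varphi(x_i))\in\ell_q$ for every $\varphi\in E^*$; it belongs to $\ell_q^u(E)$ if moreover $\|(0,\dots,0,x_{N+1},x_{N+2},\dots)\|_q^w\to 0$ as $N\to\infty$. Further, $\ell_\infty(E)$ and $c_0(E)$ are the bounded sequences and the sequences converging to $0$ in norm. The right Chevet–Saphar tensor norm on $Z\otimes X$ is $$d_p(u)=\inf\Big\{\|(z_i)_{i=1}^n\|_{p'}^w\,\|(x_i)_{i=1}^n\|_p \;:\; u=\sum_{i=1}^n z_i\otimes x_i\Big\},$$ and $Z\hat\otimes_{d_p}X$ is the completion of $(Z\otimes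 X,d_p)$. For a bounded linear operator $U\in\mathcal{L}(Z\hat\otimes_{d_p}X,Y)$, the associated operator $U^{\#}\in\mathcal{L}(Z,\mathcal{L}(X,Y))$ is given by $(U^{\#}z)x=U(z\otimes x)$. Theorem. Let $S\in\mathcal{L}(Z,\mathcal{L}(X,Y))$. The following statements are equivalent. (a) There exists $U\in\mathcal{L}(Z\hat\otimes_{d_p}X,Y)$ such that $U^{\#}=S$. (b) There exists a constant $c>0$ such that, for all finite systems $(x_i)_{i=1}^n\subset X$ and $(z_i)_{i=1}^n\subset Z$, $$\|((Sz_i)x_i)\|_{p'}^w\le c\,\|(x_i)\|_\infty\,\|(z_i)\|_{p'}^w.$$ (b$'$) There exists a constant $c>0$ such that, for all $(x_i)\in\ell_\infty(X)$ and $(z_i)\in\ell_{p'}^w(Z)$, and for all $n\in\mathbb{N}$, $$\|((Sz_i)x_i)_{i=n}^\infty\|_{p'}^w\le c\,\|(x_i)_{i=n}^\infty\|_\infty\,\|(z_i)_{i=n}^\infty\|_{p'}^w.$$ (c) If $(x_i)\in\ell_\infty(X)$ and $(z_i)\in\ell_{p'}^w(Z)$, then $((Sz_i)x_i)\in\ell_{p'}^w(Y)$.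 (d) If $(x_i)\in c_0(X)$ and $(z_i)\in\ell_{p'}^w(Z)$, then $((Sz_i)x_i)\in\ell_{p'}^u(Y)$. (d$'$) If $(x_i)\in\ell_\infty(X)$ and $(z_i)\in\ell_{p'}^u(Z)$, then $((Sz_i)x_i)\in\ell_{p'}^u(Y)$. -/

import Mathlib

open scoped ENNReal NNReal Topology TensorProduct

noncomputable section

namespace ChevetSaphar

/-- The `ℓ_p`-norm `‖(x_i)‖_p ∈ [0, ∞]` of a finite or infinite family of vectors
(for `p = ∞` this is the supremum of the norms). -/
def seqNorm {ι E : Type*} [NormedAddCommGroup E] (p : ℝ≥0∞) (x : ι → E) : ℝ≥0∞ :=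
  if p = ∞ then ⨆ i, ‖x i‖ₑ else (∑' i, ‖x i‖ₑ ^ p.toReal) ^ p.toReal⁻¹

/-- The weak `ℓ_p`-norm `‖(x_i)‖_p^w = sup { ‖(φ(x_i))‖_p : φ ∈ B_{E*} } ∈ [0, ∞]`. -/
def weakNorm (𝕜 : Type*) {ι E : Type*} [RCLike 𝕜] [NormedAddCommGroup E] [NormedSpace 𝕜 E]
    (p : ℝ≥0∞) (x : ι → E) : ℝ≥0∞ :=
  ⨆ (φ : StrongDual 𝕜 E) (_ : ‖φ‖ ≤ 1), seqNorm p (fun i => φ (x i))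

/-- `(x_i) ∈ ℓ_p^w(E)`: for every `φ ∈ E*` the scalar sequence `(φ(x_i))` is in `ℓ_p`. -/
def WeaklySummable (𝕜 : Type*) {E : Type*} [RCLike 𝕜] [NormedAddCommGroup E] [NormedSpace 𝕜 E]
    (p : ℝ≥0∞) (x : ℕ → E) : Prop :=
  ∀ φ : StrongDual 𝕜 E, Memℓp (fun i => φ (x i)) p

/-- `(x_i) ∈ ℓ_p^u(E)`: the sequence is in `ℓ_p^w(E)` and is the limit, in the weak `ℓ_p`-norm,
of its truncations `(x_0, …, x_{N-1}, 0, 0, …)`. -/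
def UnconditionallySummable (𝕜 : Type*) {E : Type*} [RCLike 𝕜] [NormedAddCommGroup E]
    [NormedSpace 𝕜 E] (p : ℝ≥0∞) (x : ℕ → E) : Prop :=
  WeaklySummable 𝕜 p x ∧
    Filter.Tendsto (fun N : ℕ => weakNorm 𝕜 p (fun i => x i - if i < N then x i else 0))
      Filter.atTop (𝓝 0)

section Norm

variable {𝕜 Z X : Type*} [RCLike 𝕜] [NormedAddCommGroup Z] [NormedSpace 𝕜 Z]
  [NormedAddCommGroup X] [NormedSpace 𝕜 X]

/-- The right Chevet–Saphar tensor norm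
`d_p(u) = inf { ‖(z_i)‖_{p'}^w ‖(x_i)‖_p : u = ∑_{i=1}^n z_i ⊗ x_i }`. -/
def dNorm (p : ℝ≥0∞) (u : Z ⊗[𝕜] X) : ℝ≥0∞ :=
  ⨅ (n : ℕ) (z : Fin n → Z) (x : Fin n → X) (_ : u = ∑ i, z i ⊗ₜ[𝕜] x i),
    weakNorm 𝕜 p.conjExponent z * seqNorm p x

lemma dNorm_le (p : ℝ≥0∞) {u : Z ⊗[𝕜] X} {n : ℕ} (z : Fin n → Z) (x : Fin n → X)
    (h : u = ∑ i, z i ⊗ₜ[𝕜] x i) :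
    dNorm p u ≤ weakNorm 𝕜 p.conjExponent z * seqNorm p x :=
  iInf_le_of_le n (iInf_le_of_le z (iInf_le_of_le x (iInf_le _ h)))

lemma exists_of_dNorm_lt (p : ℝ≥0∞) {u : Z ⊗[𝕜] X} {a : ℝ≥0∞} (h : dNorm p u < a) :
    ∃ (n : ℕ) (z : Fin n → Z) (x : Fin n → X), u = ∑ i, z i ⊗ₜ[𝕜] x i ∧
      weakNorm 𝕜 p.conjExponent z * seqNorm p x < a := by
  simpa only [dNorm, iInf_lt_iff, exists_prop] using h

lemma one_le_conjExponent (p : ℝ≥0∞) : 1 ≤ p.conjExponent := by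
  simp [ENNReal.conjExponent]

lemma toReal_pos {p : ℝ≥0∞} (hp : 1 ≤ p) (h : p ≠ ∞) : 0 < p.toReal :=
  ENNReal.toReal_pos (by rintro rfl; simp at hp) h

lemma exists_coe_eq {a : ℝ≥0∞} (h : a ≠ ∞) : ∃ b : ℝ≥0, (b : ℝ≥0∞) = a :=
  ⟨_, ENNReal.coe_toNNReal h⟩

lemma seqNorm_fin_one {E : Type*} [NormedAddCommGroup E] {p : ℝ≥0∞} (hp : 1 ≤ p) (e : E) :
    seqNorm p (fun _ : Fin 1 => e) = ‖e‖ₑ := by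
  unfold seqNorm
  split_ifs with h
  · simp
  · simp [ENNReal.rpow_rpow_inv (toReal_pos hp h).ne']

lemma seqNorm_lt_top {E : Type*} [NormedAddCommGroup E] {p : ℝ≥0∞} {n : ℕ} (x : Fin n → E) :
    seqNorm p x < ∞ := by
  unfold seqNorm
  split_ifs with h
  · rcases isEmpty_or_nonempty (Fin n) with h0 | h0
    · simp
    · obtain ⟨i, hi⟩ := exists_eq_ciSup_of_finite (f := fun i => ‖x i‖ₑ)
      rw [← hi]
      exact enorm_lt_top
  · refine ENNReal.rpow_lt_top_of_nonneg (by positivity) ?_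
    rw [tsum_fintype]
    exact (ENNReal.sum_lt_top.2 fun i _ =>
      ENNReal.rpow_lt_top_of_nonneg (by positivity) enorm_ne_top).ne

lemma seqNorm_mono {ι E F : Type*} [NormedAddCommGroup E] [NormedAddCommGroup F] {p : ℝ≥0∞}
    {x : ι → E} {y : ι → F} (h : ∀ i, ‖x i‖ₑ ≤ ‖y i‖ₑ) : seqNorm p x ≤ seqNorm p y := by
  unfold seqNorm
  split_ifs with hp
  · exact iSup_mono h
  · gcongr with i
    exact h i

lemma seqNorm_smul_le {ι E : Type*} [NormedAddCommGroup E] [NormedSpace 𝕜 E] {p : ℝ≥0∞}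
    (hp : 1 ≤ p) (c : 𝕜) (x : ι → E) :
    seqNorm p (fun i => c • x i) ≤ ‖c‖ₑ * seqNorm p x := by
  unfold seqNorm
  split_ifs with h
  · refine iSup_le fun i => ?_
    rw [enorm_smul]
    gcongr
    exact le_iSup (fun i => ‖x i‖ₑ) i
  · have h0 := toReal_pos hp h
    simp only [enorm_smul, ENNReal.mul_rpow_of_nonneg _ _ h0.le, ENNReal.tsum_mul_left]
    rw [ENNReal.mul_rpow_of_nonneg _ _ (by positivity), ENNReal.rpow_rpow_inv h0.ne']

lemma seqNorm_append_le {E : Type*} [NormedAddCommGroup E] {p : ℝ≥0∞} (hp : 1 ≤ p) {m n : ℕ}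
    {x : Fin m → E} {y : Fin n → E} {a b : ℝ≥0∞}
    (hx : seqNorm p x ≤ a ^ p.toReal⁻¹) (hy : seqNorm p y ≤ b ^ p.toReal⁻¹) :
    seqNorm p (Fin.append x y) ≤ (a + b) ^ p.toReal⁻¹ := by
  unfold seqNorm at *
  split_ifs at * with h
  · subst h
    simp only [ENNReal.toReal_top, inv_zero, ENNReal.rpow_zero, iSup_le_iff] at *
    intro i
    induction i using Fin.addCases with
    | left i => simpa using hx i
    | right i => simpa using hy i
  · have h0 := inv_pos.2 (toReal_pos hp h)
    rw [ENNReal.rpow_le_rpow_iff h0, tsum_fintype] at *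
    rw [Fin.sum_univ_add]
    simpa using add_le_add hx hy

lemma weakNorm_append_le {E : Type*} [NormedAddCommGroup E] [NormedSpace 𝕜 E] {p : ℝ≥0∞}
    (hp : 1 ≤ p) {m n : ℕ} {x : Fin m → E} {y : Fin n → E} {a b : ℝ≥0∞}
    (hx : weakNorm 𝕜 p x ≤ a ^ p.toReal⁻¹) (hy : weakNorm 𝕜 p y ≤ b ^ p.toReal⁻¹) :
    weakNorm 𝕜 p (Fin.append x y) ≤ (a + b) ^ p.toReal⁻¹ := by
  simp only [weakNorm, iSup_le_iff] at *
  intro φ hφ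
  have : (fun i => φ (Fin.append x y i)) =
      Fin.append (fun i => φ (x i)) (fun i => φ (y i)) := by
    ext i
    induction i using Fin.addCases <;> simp
  rw [this]
  exact seqNorm_append_le hp (hx φ hφ) (hy φ hφ)

lemma weakNorm_smul_le {ι E : Type*} [NormedAddCommGroup E] [NormedSpace 𝕜 E] {p : ℝ≥0∞}
    (hp : 1 ≤ p) (c : 𝕜) (x : ι → E) :
    weakNorm 𝕜 p (fun i => c • x i) ≤ ‖c‖ₑ * weakNorm 𝕜 p x := by
  refine iSup₂_le fun φ hφ => ?_
  simp only [map_smul]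
  refine (seqNorm_smul_le hp c _).trans ?_
  gcongr
  exact le_iSup₂ (f := fun (φ : StrongDual 𝕜 E) (_ : ‖φ‖ ≤ 1) => seqNorm p (fun i => φ (x i))) φ hφ

lemma weakNorm_le_seqNorm {ι E : Type*} [NormedAddCommGroup E] [NormedSpace 𝕜 E] {p : ℝ≥0∞}
    (x : ι → E) : weakNorm 𝕜 p x ≤ seqNorm p x := by
  refine iSup₂_le fun φ hφ => seqNorm_mono fun i => ?_
  simp only [enorm_le_iff_norm_le]
  simpa using φ.le_of_opNorm_le hφ (x i)

lemma dNorm_lt_top (p : ℝ≥0∞) (u : Z ⊗[𝕜] X) : dNorm p u < ∞ := by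
  obtain ⟨n, z, x, h⟩ : ∃ (n : ℕ) (z : Fin n → Z) (x : Fin n → X),
      u = ∑ i, z i ⊗ₜ[𝕜] x i := by
    induction u with
    | zero => exact ⟨0, Fin.elim0, Fin.elim0, by simp⟩
    | tmul z x => exact ⟨1, fun _ => z, fun _ => x, by simp⟩
    | add u v hu hv =>
      obtain ⟨m, z, x, rfl⟩ := hu
      obtain ⟨n, w, y, rfl⟩ := hv
      exact ⟨m + n, Fin.append z w, Fin.append x y, by simp [Fin.sum_univ_add]⟩
  exact (dNorm_le p z x h).trans_lt (ENNReal.mul_lt_top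
    ((weakNorm_le_seqNorm z).trans_lt (seqNorm_lt_top z)) (seqNorm_lt_top x))

lemma dNorm_zero {p : ℝ≥0∞} (hp : 1 ≤ p) : dNorm p (0 : Z ⊗[𝕜] X) = 0 := by
  have h := dNorm_le p (u := (0 : Z ⊗[𝕜] X)) (n := 0) Fin.elim0 Fin.elim0 (by simp)
  have h2 : seqNorm p (Fin.elim0 : Fin 0 → X) = 0 := by
    unfold seqNorm
    split_ifs with h0
    · simp
    · have := inv_pos.2 (toReal_pos hp h0)
      rw [tsum_empty, ENNReal.zero_rpow_of_pos this]
  rw [h2, mul_zero] at h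
  exact le_antisymm h zero_le

lemma dNorm_smul_le {p : ℝ≥0∞} (hp : 1 ≤ p) (c : 𝕜) (u : Z ⊗[𝕜] X) :
    dNorm p (c • u) ≤ ‖c‖ₑ * dNorm p u := by
  rcases eq_or_ne c 0 with rfl | hc
  · simp [dNorm_zero hp]
  rw [← ENNReal.inv_mul_le_iff (by simpa using hc) enorm_ne_top]
  refine le_iInf fun n => le_iInf fun z => le_iInf fun x => le_iInf fun h => ?_
  rw [ENNReal.inv_mul_le_iff (by simpa using hc) enorm_ne_top]
  refine (dNorm_le p z (fun i => c • x i) (by simp [h, Finset.smul_sum])).trans ?_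
  rw [mul_left_comm]
  gcongr
  exact seqNorm_smul_le hp c x

lemma inv_add_inv {p : ℝ≥0∞} (hp : 1 ≤ p) : p.conjExponent.toReal⁻¹ + p.toReal⁻¹ = 1 := by
  have h : p.HolderConjugate p.conjExponent := .conjExponent hp
  have h1 := h.inv_add_inv_eq_one
  have := one_le_conjExponent p
  rw [← ENNReal.toReal_inv, ← ENNReal.toReal_inv, add_comm, ← ENNReal.toReal_add, h1]
  · simp
  · exact ENNReal.inv_ne_top.2 (by rintro rfl; simp at hp)
  · exact ENNReal.inv_ne_top.2 (by intro h; simp [h] at this)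

/-- Rescaling a representation so that both factors are controlled separately. -/
lemma exists_balanced {p : ℝ≥0∞} (hp : 1 ≤ p) {u : Z ⊗[𝕜] X} {a : ℝ≥0}
    (h : dNorm p u < a) :
    ∃ (n : ℕ) (z : Fin n → Z) (x : Fin n → X), u = ∑ i, z i ⊗ₜ[𝕜] x i ∧
      weakNorm 𝕜 p.conjExponent z ≤ (a : ℝ≥0∞) ^ p.conjExponent.toReal⁻¹ ∧
      seqNorm p x ≤ (a : ℝ≥0∞) ^ p.toReal⁻¹ := by
  obtain ⟨n, z, x, hu, hlt⟩ := exists_of_dNorm_lt p h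
  have ha : (a : ℝ≥0∞) ≠ 0 := (pos_of_gt h).ne'
  have ha0 : 0 < a := by simpa [pos_iff_ne_zero] using ha
  obtain ⟨w, hw⟩ := exists_coe_eq
    ((weakNorm_le_seqNorm (𝕜 := 𝕜) (p := p.conjExponent) z).trans_lt (seqNorm_lt_top z)).ne
  obtain ⟨s, hs⟩ := exists_coe_eq (seqNorm_lt_top (p := p) x).ne
  rw [← hw, ← hs, ← ENNReal.coe_mul, ENNReal.coe_lt_coe] at hlt
  obtain ⟨α, hα⟩ : ∃ α, α = a ^ p.conjExponent.toReal⁻¹ := ⟨_, rfl⟩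
  obtain ⟨β, hβ⟩ : ∃ β, β = a ^ p.toReal⁻¹ := ⟨_, rfl⟩
  have hα0 : 0 < α := hα ▸ NNReal.rpow_pos ha0
  have hβ0 : 0 < β := hβ ▸ NNReal.rpow_pos ha0
  have hαβ : α * β = a := by
    rw [hα, hβ, ← NNReal.rpow_add ha0.ne', inv_add_inv hp, NNReal.rpow_one]
  rw [← ENNReal.coe_rpow_of_ne_zero ha0.ne', ← ENNReal.coe_rpow_of_ne_zero ha0.ne', ← hα, ← hβ]
  obtain ⟨t, ht0, ht1, ht2⟩ : ∃ t : ℝ≥0, 0 < t ∧ t * w ≤ α ∧ t⁻¹ * s ≤ β := by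
    rcases eq_or_ne w 0 with rfl | hw0
    · refine ⟨s / β + 1, by positivity, by simp, ?_⟩
      rw [inv_mul_le_iff₀ (by positivity), add_mul, div_mul_cancel₀ _ hβ0.ne']
      exact le_self_add
    · refine ⟨α / w, by positivity, (div_mul_cancel₀ _ hw0).le, ?_⟩
      rw [inv_mul_le_iff₀ (by positivity), div_mul_eq_mul_div, hαβ,
        le_div_iff₀ (by positivity), mul_comm]
      exact hlt.le
  have htk : ((t : ℝ) : 𝕜) ≠ 0 := by exact_mod_cast ht0.ne'
  have he : ‖((t : ℝ) : 𝕜)‖ₑ = t := by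
    rw [← ofReal_norm, RCLike.norm_ofReal, NNReal.abs_eq, ENNReal.ofReal_coe_nnreal]
  refine ⟨n, fun i => ((t : ℝ) : 𝕜) • z i, fun i => ((t : ℝ) : 𝕜)⁻¹ • x i, ?_, ?_, ?_⟩
  · rw [hu]
    refine Finset.sum_congr rfl fun i _ => ?_
    rw [TensorProduct.smul_tmul, smul_inv_smul₀ htk]
  · refine (weakNorm_smul_le (one_le_conjExponent p) _ z).trans ?_
    rw [he, ← hw]
    exact_mod_cast ht1
  · refine (seqNorm_smul_le hp _ x).trans ?_
    rw [enorm_inv htk, he, ← hs, ← ENNReal.coe_inv ht0.ne']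
    exact_mod_cast ht2

lemma dNorm_add_le {p : ℝ≥0∞} (hp : 1 ≤ p) (u v : Z ⊗[𝕜] X) :
    dNorm p (u + v) ≤ dNorm p u + dNorm p v := by
  obtain ⟨a, ha⟩ := exists_coe_eq (dNorm_lt_top p u).ne
  obtain ⟨b, hb⟩ := exists_coe_eq (dNorm_lt_top p v).ne
  refine ENNReal.le_of_forall_pos_le_add fun ε hε _ => ?_
  obtain ⟨m, z, x, hu, hz, hx⟩ := exists_balanced hp (u := u) (a := a + ε / 2)
    (by rw [← ha, ENNReal.coe_lt_coe]; exact lt_add_of_pos_right _ (by positivity))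
  obtain ⟨n, w, y, hv, hw, hy⟩ := exists_balanced hp (u := v) (a := b + ε / 2)
    (by rw [← hb, ENNReal.coe_lt_coe]; exact lt_add_of_pos_right _ (by positivity))
  refine (dNorm_le p (Fin.append z w) (Fin.append x y)
    (by simp [hu, hv, Fin.sum_univ_add])).trans ?_
  refine (mul_le_mul' (weakNorm_append_le (one_le_conjExponent p) hz hw)
    (seqNorm_append_le hp hx hy)).trans ?_
  rw [← ENNReal.rpow_add_of_nonneg _ _ (by positivity) (by positivity), inv_add_inv hp,
    ENNReal.rpow_one, ← ha, ← hb]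
  refine le_of_eq ?_
  norm_cast
  rw [add_add_add_comm, add_halves]

/-- `d_p` as a real-valued seminorm on the algebraic tensor product. -/
def dSeminorm (p : ℝ≥0∞) [hp : Fact (1 ≤ p)] : Seminorm 𝕜 (Z ⊗[𝕜] X) :=
  .ofSMulLE (fun u => (dNorm p u).toReal)
    (by simp [dNorm_zero hp.out])
    (fun u v => by
      rw [← ENNReal.toReal_add (dNorm_lt_top p u).ne (dNorm_lt_top p v).ne]
      exact ENNReal.toReal_mono
        (ENNReal.add_lt_top.2 ⟨dNorm_lt_top p u, dNorm_lt_top p v⟩).ne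
        (dNorm_add_le hp.out u v))
    (fun c u => by
      rw [← toReal_enorm, ← ENNReal.toReal_mul]
      exact ENNReal.toReal_mono (ENNReal.mul_lt_top enorm_lt_top (dNorm_lt_top p u)).ne
        (dNorm_smul_le hp.out c u))

end Norm

/-- `Z ⊗_{d_p} X`: the algebraic tensor product, equipped with `d_p`. -/
def DTensor (𝕜 Z X : Type*) [RCLike 𝕜] [NormedAddCommGroup Z] [NormedSpace 𝕜 Z]
    [NormedAddCommGroup X] [NormedSpace 𝕜 X] (p : ℝ≥0∞) [Fact (1 ≤ p)] : Type _ :=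
  Z ⊗[𝕜] X

section Tensor

variable {𝕜 Z X Y : Type*} [RCLike 𝕜] [NormedAddCommGroup Z] [NormedSpace 𝕜 Z]
  [NormedAddCommGroup X] [NormedSpace 𝕜 X] [NormedAddCommGroup Y] [NormedSpace 𝕜 Y]
  {p : ℝ≥0∞} [Fact (1 ≤ p)]

instance : AddCommGroup (DTensor 𝕜 Z X p) := inferInstanceAs (AddCommGroup (Z ⊗[𝕜] X))

instance : Module 𝕜 (DTensor 𝕜 Z X p) := inferInstanceAs (Module 𝕜 (Z ⊗[𝕜] X))

instance : SeminormedAddCommGroup (DTensor 𝕜 Z X p) :=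
  AddGroupSeminorm.toSeminormedAddCommGroup
    (dSeminorm (𝕜 := 𝕜) (Z := Z) (X := X) p).toAddGroupSeminorm

instance : NormedSpace 𝕜 (DTensor 𝕜 Z X p) :=
  ⟨fun c u => ((dSeminorm (𝕜 := 𝕜) (Z := Z) (X := X) p).smul' c u).le⟩

/-- The elementary tensor `z ⊗ x` as an element of `Z ⊗_{d_p} X`. -/
def DTensor.tmul (𝕜 : Type*) {Z X : Type*} [RCLike 𝕜] [NormedAddCommGroup Z] [NormedSpace 𝕜 Z]
    [NormedAddCommGroup X] [NormedSpace 𝕜 X] (p : ℝ≥0∞) [Fact (1 ≤ p)] (z : Z) (x : X) :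
    DTensor 𝕜 Z X p :=
  z ⊗ₜ[𝕜] x

lemma DTensor.norm_tmul_le (z : Z) (x : X) : ‖DTensor.tmul 𝕜 p z x‖ ≤ ‖z‖ * ‖x‖ := by
  have hp : 1 ≤ p := Fact.out
  have h := dNorm_le p (u := z ⊗ₜ[𝕜] x) (fun _ : Fin 1 => z) (fun _ => x) (by simp)
  have h2 : dNorm p (z ⊗ₜ[𝕜] x) ≤ ‖z‖ₑ * ‖x‖ₑ := by
    refine h.trans (mul_le_mul' ?_ (seqNorm_fin_one hp x).le)
    exact (weakNorm_le_seqNorm _).trans (seqNorm_fin_one (one_le_conjExponent p) z).le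
  have h3 := ENNReal.toReal_mono (ENNReal.mul_lt_top enorm_lt_top enorm_lt_top).ne h2
  rwa [ENNReal.toReal_mul, toReal_enorm, toReal_enorm] at h3

end Tensor

/-- The completed tensor product `Z ⊗̂_{d_p} X`. -/
abbrev CTensor (𝕜 Z X : Type*) [RCLike 𝕜] [NormedAddCommGroup Z] [NormedSpace 𝕜 Z]
    [NormedAddCommGroup X] [NormedSpace 𝕜 X] (p : ℝ≥0∞) [Fact (1 ≤ p)] : Type _ :=
  UniformSpace.Completion (DTensor 𝕜 Z X p)

section Associated

variable {𝕜 Z X Y : Type*} [RCLike 𝕜] [NormedAddCommGroup Z] [NormedSpace 𝕜 Z]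
  [NormedAddCommGroup X] [NormedSpace 𝕜 X] [NormedAddCommGroup Y] [NormedSpace 𝕜 Y]
  {p : ℝ≥0∞} [Fact (1 ≤ p)]

/-- The operator `U^# ∈ L(Z, L(X, Y))` associated to `U ∈ L(Z ⊗̂_{d_p} X, Y)`:
`(U^# z) x = U (z ⊗ x)`. -/
def associated (U : CTensor 𝕜 Z X p →L[𝕜] Y) : Z →L[𝕜] X →L[𝕜] Y :=
  LinearMap.mkContinuous₂
    (LinearMap.mk₂ 𝕜
      (fun z x => U ((DTensor.tmul 𝕜 p z x : DTensor 𝕜 Z X p) : CTensor 𝕜 Z X p))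
      (fun z w x => by
        rw [← map_add, ← UniformSpace.Completion.coe_add]
        exact congrArg (fun t : DTensor 𝕜 Z X p => U (t : CTensor 𝕜 Z X p))
          (TensorProduct.add_tmul z w x))
      (fun c z x => by
        rw [← map_smul, ← UniformSpace.Completion.coe_smul]
        exact congrArg (fun t : DTensor 𝕜 Z X p => U (t : CTensor 𝕜 Z X p))
          (TensorProduct.smul_tmul' c z x).symm)
      (fun z x y => by
        rw [← map_add, ← UniformSpace.Completion.coe_add]
        exact congrArg (fun t : DTensor 𝕜 Z X p => U (t : CTensor 𝕜 Z X p))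
          (TensorProduct.tmul_add z x y))
      (fun c z x => by
        rw [← map_smul, ← UniformSpace.Completion.coe_smul]
        exact congrArg (fun t : DTensor 𝕜 Z X p => U (t : CTensor 𝕜 Z X p))
          (TensorProduct.tmul_smul c z x)))
    ‖U‖
    (fun z x => by
      simp only [LinearMap.mk₂_apply]
      refine (U.le_opNorm _).trans ?_
      rw [UniformSpace.Completion.norm_coe, mul_assoc]
      gcongr
      exact DTensor.norm_tmul_le z x)

lemma associated_apply (U : CTensor 𝕜 Z X p →L[𝕜] Y) (z : Z) (x : X) :
    associated U z x = U ((DTensor.tmul 𝕜 p z x : DTensor 𝕜 Z X p) : CTensor 𝕜 Z X p) :=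
  rfl

end Associated

end ChevetSaphar

end

/-!
Everything passes through the inequality (b) for finite systems.

The equivalence with the existence of `U` is the duality between `ℓ_p` and `ℓ_{p'}`. Given `U`, the
`ℓ_{p'}`-norm of `(φ(U(z_i ⊗ x_i)))` is attained by testing against scalars `a` in the unit ball
of `ℓ_p`, and this evaluates `φ ∘ U` at `∑ z_i ⊗ a_i x_i`, whose `d_p`-norm is controlled
(`weakNorm_associated_le`). Conversely, writing `x_i = ‖x_i‖ e_i` and applying Hölder's inequality
shows that `z ⊗ x ↦ (S z) x` is `d_p`-bounded (`enorm_sum_apply_le`), so it extends to the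
completion (`exists_associated_eq`).

The inequality passes to infinite sequences since the weak norm of a sequence is the supremum of
those of its initial segments. As weakly summable sequences have finite weak norm, by the closed
graph theorem (`WeaklySummable.weakNorm_lt_top`), the inequality on sequences and their tails gives
all the mapping properties (c), (d), (d').

In the other direction, each of the mapping properties implies that `((S z_i) x_i)` is weakly
summable for null `(x_i)` and weakly summable `(z_i)`. In the case of (d') a null scalar factor is
moved from `(x_i)` to `(z_i)` (`weaklySummable_apply_of_unconditionallySummable`). If the finite
inequality failed, violating systems, rescaled to have geometrically decreasing norms, could be
glued into one null and one weakly summable sequence whose image has infinite weak norm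
(`exists_forall_weakNorm_apply_le`).
-/

namespace ChevetSaphar

/-! ### The strong `ℓ_q`-norm -/

lemma seqNorm_top {ι E : Type*} [NormedAddCommGroup E] (x : ι → E) :
    seqNorm ∞ x = ⨆ i, ‖x i‖ₑ := if_pos rfl

lemma seqNorm_of_ne_top {ι E : Type*} [NormedAddCommGroup E] {q : ℝ≥0∞} (h : q ≠ ∞) (x : ι → E) :
    seqNorm q x = (∑' i, ‖x i‖ₑ ^ q.toReal) ^ q.toReal⁻¹ := if_neg h

lemma seqNorm_le_iff_of_ne_top {ι E : Type*} [NormedAddCommGroup E] {q : ℝ≥0∞} (hq : 1 ≤ q)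
    (h : q ≠ ∞) (x : ι → E) (C : ℝ≥0∞) :
    seqNorm q x ≤ C ↔ ∑' i, ‖x i‖ₑ ^ q.toReal ≤ C ^ q.toReal := by
  rw [seqNorm_of_ne_top h, ENNReal.rpow_inv_le_iff (toReal_pos hq h)]

lemma seqNorm_one {ι E : Type*} [NormedAddCommGroup E] (x : ι → E) :
    seqNorm 1 x = ∑' i, ‖x i‖ₑ := by
  simp [seqNorm_of_ne_top]

lemma seqNorm_comp_le {ι κ E : Type*} [NormedAddCommGroup E] {q : ℝ≥0∞} {f : κ → ι}
    (hf : f.Injective) (x : ι → E) : seqNorm q (fun k => x (f k)) ≤ seqNorm q x := by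
  unfold seqNorm
  split_ifs
  · exact iSup_le fun k => le_iSup (fun i => ‖x i‖ₑ) (f k)
  · gcongr
    exact ENNReal.tsum_comp_le_tsum_of_injective hf (fun i => ‖x i‖ₑ ^ q.toReal)

lemma seqNorm_le_of_fin {E : Type*} [NormedAddCommGroup E] {q : ℝ≥0∞} (hq : 1 ≤ q) {x : ℕ → E}
    {C : ℝ≥0∞} (h : ∀ n, seqNorm q (fun i : Fin n => x i) ≤ C) : seqNorm q x ≤ C := by
  rcases eq_or_ne q ∞ with rfl | hq'
  · rw [seqNorm_top]
    refine iSup_le fun i => ?_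
    have := h (i + 1)
    rw [seqNorm_top, iSup_le_iff] at this
    exact this (Fin.last i)
  · simp only [seqNorm_le_iff_of_ne_top hq hq'] at h ⊢
    rw [ENNReal.tsum_eq_iSup_nat]
    refine iSup_le fun n => ?_
    rw [Finset.sum_range, ← tsum_fintype (L := .unconditional _)]
    exact h n

lemma enorm_le_seqNorm {ι E : Type*} [NormedAddCommGroup E] {q : ℝ≥0∞} (hq : 1 ≤ q) (x : ι → E)
    (i : ι) : ‖x i‖ₑ ≤ seqNorm q x := by
  rw [← seqNorm_fin_one hq (x i)]
  exact seqNorm_comp_le (f := fun _ : Fin 1 => i) (fun _ _ _ => Subsingleton.elim _ _) x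

lemma memℓp_iff_seqNorm_lt_top {ι E : Type*} [NormedAddCommGroup E] {q : ℝ≥0∞} (hq : 1 ≤ q)
    {x : ι → E} : Memℓp x q ↔ seqNorm q x < ∞ := by
  rcases eq_or_ne q ∞ with rfl | hq'
  · rw [memℓp_infty_iff, seqNorm_top]
    constructor
    · rintro ⟨C, hC⟩
      refine lt_of_le_of_lt (b := ENNReal.ofReal C) (iSup_le fun i => ?_) ENNReal.ofReal_lt_top
      rw [← ofReal_norm]
      exact ENNReal.ofReal_le_ofReal (hC ⟨i, rfl⟩)
    · intro h
      refine ⟨(⨆ i, ‖x i‖ₑ).toReal, ?_⟩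
      rintro _ ⟨i, rfl⟩
      dsimp only
      rw [← toReal_enorm]
      exact ENNReal.toReal_mono h.ne (le_iSup (fun i => ‖x i‖ₑ) i)
  · have h0 := toReal_pos hq hq'
    rw [memℓp_gen_iff h0, seqNorm_of_ne_top hq', ENNReal.rpow_lt_top_iff_of_pos (inv_pos.2 h0),
      lt_top_iff_ne_top]
    have : ∀ i, ‖x i‖ₑ ^ q.toReal = ‖‖x i‖ ^ q.toReal‖ₑ := fun i => by
      rw [Real.enorm_rpow_of_nonneg (norm_nonneg _) h0.le, enorm_norm]
    simp only [this]
    rw [tsum_enorm_ne_top_iff_summable_norm, summable_norm_iff]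

lemma seqNorm_lp_le {ι E : Type*} [NormedAddCommGroup E] {q : ℝ≥0∞} [Fact (1 ≤ q)]
    (f : lp (fun _ : ι => E) q) : seqNorm q (fun i => f i) ≤ ‖f‖ₑ := by
  have hq : 1 ≤ q := Fact.out
  rcases eq_or_ne q ∞ with rfl | hq'
  · rw [seqNorm_top]
    refine iSup_le fun i => ?_
    rw [enorm_le_iff_norm_le]
    exact lp.norm_apply_le_norm (by simp) f i
  · have h0 := toReal_pos hq hq'
    rw [seqNorm_le_iff_of_ne_top hq hq', ← enorm_norm f,
      ← Real.enorm_rpow_of_nonneg (norm_nonneg _) h0.le, lp.norm_rpow_eq_tsum h0,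
      Real.enorm_of_nonneg (tsum_nonneg fun i => by positivity),
      ENNReal.ofReal_tsum_of_nonneg (fun i => by positivity)
        ((memℓp_gen_iff h0).1 (lp.memℓp f))]
    refine le_of_eq (tsum_congr fun i => ?_)
    rw [← ENNReal.ofReal_rpow_of_nonneg (norm_nonneg _) h0.le, ofReal_norm]

lemma seqNorm_le_mul_of_enorm_le {ι E F : Type*} [NormedAddCommGroup E] [NormedAddCommGroup F]
    {q : ℝ≥0∞} (hq : 1 ≤ q) {x : ι → E} {y : ι → F} {C : ℝ≥0∞}
    (h : ∀ i, ‖y i‖ₑ ≤ C * ‖x i‖ₑ) : seqNorm q y ≤ C * seqNorm q x := by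
  rcases eq_or_ne q ∞ with rfl | hq'
  · rw [seqNorm_top, seqNorm_top, ENNReal.mul_iSup]
    exact iSup_mono h
  · have h0 := toReal_pos hq hq'
    rw [seqNorm_le_iff_of_ne_top hq hq', ENNReal.mul_rpow_of_nonneg _ _ h0.le,
      seqNorm_of_ne_top hq', ENNReal.rpow_inv_rpow h0.ne', ← ENNReal.tsum_mul_left]
    refine ENNReal.tsum_le_tsum fun i => ?_
    rw [← ENNReal.mul_rpow_of_nonneg _ _ h0.le]
    exact ENNReal.rpow_le_rpow (h i) h0.le

/-! ### Duality of finite strong norms -/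

/-- Conjugate indices in the range `[1, ∞]`: either both are finite, and then `> 1`, or the pair
is `(1, ∞)` or `(∞, 1)`. -/
lemma conjExponent_cases {p : ℝ≥0∞} (hp : 1 ≤ p) :
    (p = 1 ∧ p.conjExponent = ∞) ∨ (p = ∞ ∧ p.conjExponent = 1) ∨
      (p ≠ ∞ ∧ p.conjExponent ≠ ∞ ∧ p.toReal.HolderConjugate p.conjExponent.toReal) := by
  have h : p.HolderConjugate p.conjExponent := .conjExponent hp
  by_cases h1 : p = ∞
  · simp [h1, ENNReal.conjExponent]
  by_cases h2 : p.conjExponent = ∞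
  · have := h.inv_add_inv_eq_one
    rw [h2] at this
    left
    exact ⟨by simpa using this, h2⟩
  · exact .inr (.inr ⟨h1, h2, ENNReal.HolderConjugate.toReal_of_ne_top h1 h2⟩)

/-- Hölder's inequality for finite families. -/
lemma sum_enorm_mul_le {ι E F : Type*} [Fintype ι] [NormedAddCommGroup E] [NormedAddCommGroup F]
    {p : ℝ≥0∞} (hp : 1 ≤ p) (a : ι → E) (b : ι → F) :
    ∑ i, ‖a i‖ₑ * ‖b i‖ₑ ≤ seqNorm p a * seqNorm p.conjExponent b := by
  rcases conjExponent_cases hp with ⟨h1, h2⟩ | ⟨h1, h2⟩ | ⟨h1, h2, h⟩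
  · rw [h2, h1, seqNorm_one, tsum_fintype, Finset.sum_mul]
    gcongr with i
    exact enorm_le_seqNorm le_top b i
  · rw [h2, h1, seqNorm_one, tsum_fintype, Finset.mul_sum]
    gcongr with i
    exact enorm_le_seqNorm le_top a i
  · rw [seqNorm_of_ne_top h1, seqNorm_of_ne_top h2, tsum_fintype, tsum_fintype]
    simpa using ENNReal.inner_le_Lp_mul_Lq Finset.univ (fun i => ‖a i‖ₑ) (fun i => ‖b i‖ₑ) h

/-- The supremum in the dual description of the `ℓ_{p'}`-norm of a finite family of scalars is
attained. -/
lemma exists_sum_mul_eq_seqNorm {𝕜 ι : Type*} [RCLike 𝕜] [Fintype ι] {p : ℝ≥0∞} (hp : 1 ≤ p)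
    (b : ι → 𝕜) :
    ∃ a : ι → 𝕜, seqNorm p a ≤ 1 ∧ ‖∑ i, a i * b i‖ₑ = seqNorm p.conjExponent b := by
  classical
  -- It suffices to find nonnegative weights; the phases of `b` are then put in by hand.
  suffices H : ∃ g : ι → ℝ≥0, seqNorm p (fun i => (g i : ℝ)) ≤ 1 ∧
      ((∑ i, ‖b i‖₊ * g i : ℝ≥0) : ℝ≥0∞) = seqNorm p.conjExponent b by
    obtain ⟨g, hg, hgb⟩ := H
    choose s hs hsb using fun i => RCLike.exists_norm_eq_mul_self (b i)
    refine ⟨fun i => ((g i : ℝ) : 𝕜) * s i, ?_, ?_⟩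
    · refine (seqNorm_mono fun i => ?_).trans hg
      rw [enorm_le_iff_norm_le, norm_mul, hs, mul_one, RCLike.norm_ofReal, Real.norm_eq_abs]
    · have : ∑ i, ((g i : ℝ) : 𝕜) * s i * b i = (((∑ i, ‖b i‖₊ * g i : ℝ≥0) : ℝ) : 𝕜) := by
        push_cast
        refine Finset.sum_congr rfl fun i _ => ?_
        rw [mul_assoc, ← hsb, mul_comm]
      rw [this, ← hgb, ← ofReal_norm, RCLike.norm_ofReal, NNReal.abs_eq, ENNReal.ofReal_coe_nnreal]
  rcases conjExponent_cases hp with ⟨h1, h2⟩ | ⟨h1, h2⟩ | ⟨h1, h2, h⟩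
  · rw [h2, h1]
    simp only [seqNorm_one, tsum_fintype, seqNorm_top]
    rcases isEmpty_or_nonempty ι with h0 | h0
    · exact ⟨0, by simp⟩
    · obtain ⟨j, hj⟩ := exists_eq_ciSup_of_finite (f := fun i => ‖b i‖ₑ)
      refine ⟨Pi.single j 1, ?_, ?_⟩
      · rw [Finset.sum_eq_single j (fun i _ hi => by simp [hi]) (by simp)]
        simp
      · rw [← hj, Finset.sum_eq_single j (fun i _ hi => by simp [hi]) (by simp)]
        simp [enorm_eq_nnnorm]
  · rw [h2, h1]
    exact ⟨1, by simp [seqNorm_top], by simp [seqNorm_one, tsum_fintype, enorm_eq_nnnorm]⟩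
  · obtain ⟨⟨g, hg, hgb⟩, -⟩ := NNReal.isGreatest_Lp Finset.univ (fun i => ‖b i‖₊) h.symm
    have hq := toReal_pos (one_le_conjExponent p) h2
    refine ⟨g, ?_, ?_⟩
    · rw [seqNorm_le_iff_of_ne_top hp h1, ENNReal.one_rpow, tsum_fintype]
      have hg' : ∑ i, g i ^ p.toReal ≤ 1 := hg
      have e : ∀ i, ‖(g i : ℝ)‖ₑ ^ p.toReal = ((g i ^ p.toReal : ℝ≥0) : ℝ≥0∞) := fun i => by
        rw [ENNReal.coe_rpow_of_nonneg _ (toReal_pos hp h1).le, Real.enorm_of_nonneg (g i).coe_nonneg,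
          ENNReal.ofReal_coe_nnreal]
      simp only [e]
      exact_mod_cast hg'
    · rw [seqNorm_of_ne_top h2, tsum_fintype]
      dsimp only at hgb
      rw [hgb, one_div, ENNReal.coe_rpow_of_nonneg _ (inv_pos.2 hq).le]
      push_cast
      simp only [ENNReal.coe_rpow_of_nonneg _ hq.le, enorm_eq_nnnorm]

/-! ### The weak `ℓ_q`-norm -/

section Weak

variable {𝕜 E F : Type*} [RCLike 𝕜] [NormedAddCommGroup E] [NormedSpace 𝕜 E]
  [NormedAddCommGroup F] [NormedSpace 𝕜 F] {q : ℝ≥0∞}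

lemma seqNorm_le_weakNorm {ι : Type*} (x : ι → E) (φ : StrongDual 𝕜 E) (hφ : ‖φ‖ ≤ 1) :
    seqNorm q (fun i => φ (x i)) ≤ weakNorm 𝕜 q x :=
  le_iSup₂ (f := fun (φ : StrongDual 𝕜 E) (_ : ‖φ‖ ≤ 1) => seqNorm q (fun i => φ (x i))) φ hφ

lemma weakNorm_comp_le {ι κ : Type*} {f : κ → ι} (hf : f.Injective) (x : ι → E) :
    weakNorm 𝕜 q (fun k => x (f k)) ≤ weakNorm 𝕜 q x :=
  iSup₂_mono fun φ _ => seqNorm_comp_le hf fun i => φ (x i)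

lemma weakNorm_le_of_fin (hq : 1 ≤ q) {x : ℕ → E} {C : ℝ≥0∞}
    (h : ∀ n, weakNorm 𝕜 q (fun i : Fin n => x i) ≤ C) : weakNorm 𝕜 q x ≤ C :=
  iSup₂_le fun φ hφ => seqNorm_le_of_fin hq fun n => (seqNorm_le_weakNorm _ φ hφ).trans (h n)

lemma enorm_le_weakNorm (hq : 1 ≤ q) {ι : Type*} (x : ι → E) (i : ι) :
    ‖x i‖ₑ ≤ weakNorm 𝕜 q x := by
  obtain ⟨φ, hφ, h⟩ := exists_dual_vector'' 𝕜 (x i)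
  refine le_trans ?_ (seqNorm_le_weakNorm x φ hφ)
  refine le_trans ?_ (enorm_le_seqNorm hq _ i)
  rw [h, enorm_le_iff_norm_le]
  simp

lemma weakNorm_lt_top_of_fin {n : ℕ} (x : Fin n → E) : weakNorm 𝕜 q x < ∞ :=
  (weakNorm_le_seqNorm x).trans_lt (seqNorm_lt_top x)

lemma weaklySummable_of_weakNorm_lt_top (hq : 1 ≤ q) {x : ℕ → E} (h : weakNorm 𝕜 q x < ∞) :
    WeaklySummable 𝕜 q x := by
  intro φ
  rcases eq_or_ne φ 0 with rfl | hφ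
  · exact zero_memℓp
  · have h0 : ((‖φ‖ : ℝ) : 𝕜) ≠ 0 := by simpa using hφ
    have h1 : Memℓp (fun i => ((((‖φ‖ : ℝ) : 𝕜)⁻¹) • φ) (x i)) q := by
      refine (memℓp_iff_seqNorm_lt_top hq).2 ((seqNorm_le_weakNorm x _ ?_).trans_lt h)
      rw [norm_smul, norm_inv, RCLike.norm_ofReal, abs_norm, inv_mul_cancel₀ (by simpa using hφ)]
    convert h1.const_smul ((‖φ‖ : ℝ) : 𝕜) using 1
    ext i
    simp [h0]

/-- A weakly `q`-summable sequence has finite weak norm: the map `φ ↦ (φ(x_i))` from `E*` to `ℓ_q`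
has closed graph, hence is bounded. -/
lemma WeaklySummable.weakNorm_lt_top (hq : 1 ≤ q) {x : ℕ → E} (h : WeaklySummable 𝕜 q x) :
    weakNorm 𝕜 q x < ∞ := by
  have : Fact (1 ≤ q) := ⟨hq⟩
  let g : StrongDual 𝕜 E →ₗ[𝕜] lp (fun _ : ℕ => 𝕜) q :=
    { toFun φ := ⟨fun i => φ (x i), h φ⟩
      map_add' φ ψ := rfl
      map_smul' c φ := rfl }
  have hg : ∀ φ i, g φ i = φ (x i) := fun _ _ => rfl
  have hc : Continuous g := by
    refine g.continuous_of_seq_closed_graph fun u φ y hu hy => ?_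
    ext i
    have h1 : Filter.Tendsto (fun n => u n (x i)) Filter.atTop (𝓝 (φ (x i))) :=
      ((ContinuousLinearMap.apply 𝕜 𝕜 (x i)).continuous.tendsto φ).comp hu
    have h2 : Filter.Tendsto (fun n => u n (x i)) Filter.atTop (𝓝 (y i)) := by
      rw [tendsto_iff_norm_sub_tendsto_zero] at hy ⊢
      refine squeeze_zero (fun _ => norm_nonneg _) (fun n => ?_) hy
      exact lp.norm_apply_le_norm (zero_lt_one.trans_le hq).ne' ((g ∘ u) n - y) i
    exact tendsto_nhds_unique h2 h1
  let G : StrongDual 𝕜 E →L[𝕜] lp (fun _ : ℕ => 𝕜) q := ⟨g, hc⟩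
  refine lt_of_le_of_lt (b := ‖G‖ₑ) (iSup₂_le fun φ hφ => ?_) enorm_lt_top
  refine (seqNorm_lp_le (g φ)).trans ?_
  rw [enorm_le_iff_norm_le]
  exact G.le_of_opNorm_le_of_le le_rfl hφ |>.trans (mul_one _).le

lemma weakNorm_sub_truncation (hq : 1 ≤ q) (x : ℕ → E) (N : ℕ) :
    weakNorm 𝕜 q (fun i => x i - if i < N then x i else 0) =
      weakNorm 𝕜 q (fun i => x (N + i)) := by
  have key : ∀ φ : StrongDual 𝕜 E,
      seqNorm q (fun i => φ (x i - if i < N then x i else 0)) =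
        seqNorm q (fun i => φ (x (N + i))) := by
    intro φ
    apply le_antisymm
    · rcases eq_or_ne q ∞ with rfl | hq'
      · rw [seqNorm_top, seqNorm_top]
        refine iSup_le fun i => ?_
        split_ifs with hi
        · simp
        · obtain ⟨j, rfl⟩ := Nat.exists_eq_add_of_le (not_lt.1 hi)
          simpa using le_iSup (fun i => ‖φ (x (N + i))‖ₑ) j
      · have h0 := toReal_pos hq hq'
        rw [seqNorm_of_ne_top hq', seqNorm_of_ne_top hq']
        refine ENNReal.rpow_le_rpow ?_ (inv_pos.2 h0).le
        rw [← ENNReal.summable.sum_add_tsum_nat_add' (k := N), Finset.sum_eq_zero, zero_add]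
        · simp [add_comm N]
        · intro i hi
          rw [if_pos (Finset.mem_range.1 hi), sub_self, map_zero, enorm_zero,
            ENNReal.zero_rpow_of_pos h0]
    · simpa using seqNorm_comp_le (q := q) (add_right_injective N)
        (fun i => φ (x i - if i < N then x i else 0))
  simp only [weakNorm, key]

end Weak

/-! ### Operators on `Z ⊗̂_{d_p} X` and the finite inequality -/

lemma exists_eq_norm_smul {𝕜 E : Type*} [RCLike 𝕜] [NormedAddCommGroup E] [NormedSpace 𝕜 E]
    (x : E) : ∃ e : E, ‖e‖ₑ ≤ 1 ∧ x = ((‖x‖ : ℝ) : 𝕜) • e := by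
  rcases eq_or_ne x 0 with rfl | hx
  · exact ⟨0, by simp⟩
  · have h : ‖x‖ ≠ 0 := norm_ne_zero_iff.2 hx
    refine ⟨((‖x‖ : ℝ) : 𝕜)⁻¹ • x, ?_, ?_⟩
    · rw [← ofReal_norm, norm_smul, norm_inv, RCLike.norm_ofReal, abs_norm, inv_mul_cancel₀ h]
      simp
    · rw [smul_inv_smul₀ (by exact_mod_cast h)]

section Operators

variable {𝕜 X Y Z : Type*} [RCLike 𝕜] [NormedAddCommGroup X] [NormedSpace 𝕜 X]
  [NormedAddCommGroup Y] [NormedSpace 𝕜 Y] [NormedAddCommGroup Z] [NormedSpace 𝕜 Z]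
  {p q : ℝ≥0∞}

/-- Testing `(φ(U(z_i ⊗ x_i)))` against scalars `a_i` amounts to applying `φ ∘ U` to the tensor
`∑ z_i ⊗ a_i x_i`, whose `d_p`-norm is at most `‖z‖_{p'}^w ‖a‖_p ‖x‖_∞`. -/
lemma weakNorm_associated_le [Fact (1 ≤ p)] (U : CTensor 𝕜 Z X p →L[𝕜] Y) {n : ℕ}
    (x : Fin n → X) (z : Fin n → Z) :
    weakNorm 𝕜 p.conjExponent (fun i => associated U (z i) (x i)) ≤
      ‖U‖ₑ * seqNorm ∞ x * weakNorm 𝕜 p.conjExponent z := by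
  have hp : 1 ≤ p := Fact.out
  refine iSup₂_le fun φ hφ => ?_
  obtain ⟨a, ha, hab⟩ := exists_sum_mul_eq_seqNorm hp (fun i => φ (associated U (z i) (x i)))
  rw [← hab]
  let u : DTensor 𝕜 Z X p := ∑ i, DTensor.tmul 𝕜 p (z i) (a i • x i)
  have hu : ∑ i, a i * φ (associated U (z i) (x i)) = φ (U (u : CTensor 𝕜 Z X p)) := by
    have : (u : CTensor 𝕜 Z X p) =
        ∑ i, ((DTensor.tmul 𝕜 p (z i) (a i • x i) : DTensor 𝕜 Z X p) : CTensor 𝕜 Z X p) :=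
      map_sum (UniformSpace.Completion.toComplL (𝕜 := 𝕜) (E := DTensor 𝕜 Z X p)) _ _
    rw [this, map_sum, map_sum]
    refine Finset.sum_congr rfl fun i _ => ?_
    rw [← associated_apply, map_smul, map_smul, smul_eq_mul]
  have hd : ‖u‖ₑ = dNorm p (show Z ⊗[𝕜] X from u) := by
    rw [← ofReal_norm]
    exact ENNReal.ofReal_toReal (dNorm_lt_top p _).ne
  have hd' : ‖u‖ₑ ≤ weakNorm 𝕜 p.conjExponent z * seqNorm ∞ x := by
    rw [hd]
    refine (dNorm_le p z (fun i => a i • x i) rfl).trans ?_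
    gcongr
    refine (seqNorm_le_mul_of_enorm_le hp (x := a) fun i => ?_).trans (mul_le_of_le_one_right' ha)
    rw [enorm_smul, mul_comm]
    gcongr
    exact enorm_le_seqNorm le_top x i
  have h1 : ‖φ (U (u : CTensor 𝕜 Z X p))‖ₑ ≤ ‖U (u : CTensor 𝕜 Z X p)‖ₑ := by
    rw [enorm_le_iff_norm_le]
    exact (φ.le_of_opNorm_le hφ _).trans (one_mul _).le
  have h2 : ‖U (u : CTensor 𝕜 Z X p)‖ₑ ≤ ‖U‖ₑ * ‖u‖ₑ := by
    refine (U.le_opENorm _).trans (le_of_eq ?_)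
    congr 1
    rw [← ofReal_norm, ← ofReal_norm, UniformSpace.Completion.norm_coe]
  rw [hu, mul_assoc, mul_comm (seqNorm ∞ x)]
  exact h1.trans (h2.trans (by gcongr))

/-- The inequality for finite systems bounds `∑ (S z_i) x_i` by the product defining `d_p`: write
`x_i = ‖x_i‖ e_i` with `‖e_i‖ ≤ 1` and apply Hölder's inequality to `‖x_i‖` and
`φ((S z_i) e_i)`. -/
lemma enorm_sum_apply_le (hp : 1 ≤ p) (S : Z →L[𝕜] X →L[𝕜] Y) {c : ℝ≥0∞} {n : ℕ}
    (h : ∀ (x : Fin n → X) (z : Fin n → Z),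
      weakNorm 𝕜 p.conjExponent (fun i => S (z i) (x i)) ≤
        c * seqNorm ∞ x * weakNorm 𝕜 p.conjExponent z)
    (x : Fin n → X) (z : Fin n → Z) :
    ‖∑ i, S (z i) (x i)‖ₑ ≤ c * (weakNorm 𝕜 p.conjExponent z * seqNorm p x) := by
  choose e he hxe using fun i => exists_eq_norm_smul (𝕜 := 𝕜) (x i)
  obtain ⟨φ, hφ, hφy⟩ := exists_dual_vector'' 𝕜 (∑ i, S (z i) (x i))
  calc ‖∑ i, S (z i) (x i)‖ₑ = ‖φ (∑ i, S (z i) (x i))‖ₑ := by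
        rw [hφy, ← ofReal_norm, ← ofReal_norm, RCLike.norm_ofReal, abs_norm]
    _ ≤ ∑ i, ‖φ (S (z i) (x i))‖ₑ := by
        rw [map_sum]
        exact enorm_sum_le _ _
    _ = ∑ i, ‖x i‖ₑ * ‖φ (S (z i) (e i))‖ₑ := by
        refine Finset.sum_congr rfl fun i _ => ?_
        conv_lhs => rw [hxe i, map_smul, map_smul, enorm_smul]
        rw [← ofReal_norm ((‖x i‖ : ℝ) : 𝕜), RCLike.norm_ofReal, abs_norm, ofReal_norm]
    _ ≤ seqNorm p x * seqNorm p.conjExponent (fun i => φ (S (z i) (e i))) :=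
        sum_enorm_mul_le hp _ _
    _ ≤ seqNorm p x * (c * 1 * weakNorm 𝕜 p.conjExponent z) := by
        gcongr
        refine (seqNorm_le_weakNorm (fun i => S (z i) (e i)) φ hφ).trans ((h e z).trans ?_)
        gcongr
        rw [seqNorm_top]
        exact iSup_le he
    _ = c * (weakNorm 𝕜 p.conjExponent z * seqNorm p x) := by ring

lemma exists_associated_eq [Fact (1 ≤ p)] [CompleteSpace Y] (S : Z →L[𝕜] X →L[𝕜] Y) {c : ℝ≥0}
    (hc : 0 < c)
    (h : ∀ (n : ℕ) (x : Fin n → X) (z : Fin n → Z),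
      weakNorm 𝕜 p.conjExponent (fun i => S (z i) (x i)) ≤
        c * seqNorm ∞ x * weakNorm 𝕜 p.conjExponent z) :
    ∃ U : CTensor 𝕜 Z X p →L[𝕜] Y, associated U = S := by
  have hp : 1 ≤ p := Fact.out
  let T : Z ⊗[𝕜] X →ₗ[𝕜] Y := TensorProduct.lift
    (LinearMap.mk₂ 𝕜 (fun z x => S z x) (by simp) (by simp) (by simp) (by simp))
  have hT : ∀ z x, T (z ⊗ₜ x) = S z x := fun z x => by simp [T]
  have hT_le : ∀ u, ‖T u‖ₑ ≤ c * dNorm p u := fun u => by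
    have hc' : (c : ℝ≥0∞) ≠ 0 := by exact_mod_cast hc.ne'
    rw [← ENNReal.inv_mul_le_iff hc' ENNReal.coe_ne_top]
    refine le_iInf fun n => le_iInf fun z => le_iInf fun x => le_iInf fun hu => ?_
    rw [ENNReal.inv_mul_le_iff hc' ENNReal.coe_ne_top, hu, map_sum]
    simp only [hT]
    exact enorm_sum_apply_le hp S (h n) x z
  let T' : DTensor 𝕜 Z X p →ₗ[𝕜] Y := T
  have hT' : ∀ u : DTensor 𝕜 Z X p, ‖T' u‖ ≤ c * ‖u‖ := fun u => by
    have := ENNReal.toReal_mono (ENNReal.mul_lt_top ENNReal.coe_lt_top (dNorm_lt_top p _)).ne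
      (hT_le u)
    rwa [toReal_enorm, ENNReal.toReal_mul] at this
  let e : DTensor 𝕜 Z X p →L[𝕜] CTensor 𝕜 Z X p := UniformSpace.Completion.toComplL
  refine ⟨(T'.mkContinuous c hT').extend e, ?_⟩
  ext z x
  rw [associated_apply]
  exact ((T'.mkContinuous c hT').extend_eq UniformSpace.Completion.denseRange_coe
    (UniformSpace.Completion.isUniformInducing_coe _) (DTensor.tmul 𝕜 p z x)).trans (hT z x)

/-! ### Infinite sequences -/

lemma weakNorm_apply_le_of_fin (hq : 1 ≤ q) (S : Z →L[𝕜] X →L[𝕜] Y) {c : ℝ≥0∞}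
    (h : ∀ (n : ℕ) (x : Fin n → X) (z : Fin n → Z),
      weakNorm 𝕜 q (fun i => S (z i) (x i)) ≤ c * seqNorm ∞ x * weakNorm 𝕜 q z)
    (x : ℕ → X) (z : ℕ → Z) :
    weakNorm 𝕜 q (fun i => S (z i) (x i)) ≤ c * seqNorm ∞ x * weakNorm 𝕜 q z := by
  refine weakNorm_le_of_fin hq fun n => (h n _ _).trans ?_
  gcongr
  · exact seqNorm_comp_le Fin.val_injective x
  · exact weakNorm_comp_le Fin.val_injective z

lemma weaklySummable_apply (hq : 1 ≤ q) (S : Z →L[𝕜] X →L[𝕜] Y) {c : ℝ≥0} {x : ℕ → X} {z : ℕ → Z}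
    (h : weakNorm 𝕜 q (fun i => S (z i) (x i)) ≤ c * seqNorm ∞ x * weakNorm 𝕜 q z)
    (hx : Memℓp x ∞) (hz : WeaklySummable 𝕜 q z) :
    WeaklySummable 𝕜 q (fun i => S (z i) (x i)) :=
  weaklySummable_of_weakNorm_lt_top hq <| h.trans_lt <| ENNReal.mul_lt_top
    (ENNReal.mul_lt_top ENNReal.coe_lt_top ((memℓp_iff_seqNorm_lt_top le_top).1 hx))
    (hz.weakNorm_lt_top hq)

lemma tendsto_seqNorm_top_tail {E : Type*} [NormedAddCommGroup E] {x : ℕ → E}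
    (hx : Filter.Tendsto x Filter.atTop (𝓝 0)) :
    Filter.Tendsto (fun N => seqNorm ∞ (fun i => x (N + i))) Filter.atTop (𝓝 0) := by
  rw [ENNReal.tendsto_nhds_zero]
  intro ε hε
  have hx' : Filter.Tendsto (fun i => ‖x i‖ₑ) Filter.atTop (𝓝 0) := by
    simpa using hx.enorm
  obtain ⟨N, hN⟩ := Filter.eventually_atTop.1 (ENNReal.tendsto_nhds_zero.1 hx' ε hε)
  filter_upwards [Filter.eventually_ge_atTop N] with M hM
  rw [seqNorm_top]
  exact iSup_le fun i => hN _ (by omega)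

lemma memℓp_top_of_tendsto_zero {E : Type*} [NormedAddCommGroup E] {x : ℕ → E}
    (hx : Filter.Tendsto x Filter.atTop (𝓝 0)) : Memℓp x ∞ :=
  memℓp_infty_iff.2 hx.norm.bddAbove_range

lemma unconditionallySummable_apply_of_tendsto_zero (hq : 1 ≤ q) (S : Z →L[𝕜] X →L[𝕜] Y)
    {c : ℝ≥0}
    (h : ∀ (x : ℕ → X) (z : ℕ → Z),
      weakNorm 𝕜 q (fun i => S (z i) (x i)) ≤ c * seqNorm ∞ x * weakNorm 𝕜 q z)
    {x : ℕ → X} {z : ℕ → Z} (hx : Filter.Tendsto x Filter.atTop (𝓝 0))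
    (hz : WeaklySummable 𝕜 q z) :
    UnconditionallySummable 𝕜 q (fun i => S (z i) (x i)) := by
  refine ⟨weaklySummable_apply hq S (h x z) (memℓp_top_of_tendsto_zero hx) hz, ?_⟩
  simp only [weakNorm_sub_truncation hq]
  have hW := (hz.weakNorm_lt_top hq).ne
  have hlim : Filter.Tendsto
      (fun N => c * seqNorm ∞ (fun i => x (N + i)) * weakNorm 𝕜 q z) Filter.atTop (𝓝 0) := by
    simpa using ENNReal.Tendsto.mul_const
      (ENNReal.Tendsto.const_mul (tendsto_seqNorm_top_tail hx) (.inr ENNReal.coe_ne_top)) (.inr hW)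
  refine tendsto_of_tendsto_of_tendsto_of_le_of_le tendsto_const_nhds hlim (fun _ => zero_le)
    fun N => (h _ _).trans ?_
  gcongr
  exact weakNorm_comp_le (add_right_injective N) z

lemma unconditionallySummable_apply_of_memℓp (hq : 1 ≤ q) (S : Z →L[𝕜] X →L[𝕜] Y)
    {c : ℝ≥0}
    (h : ∀ (x : ℕ → X) (z : ℕ → Z),
      weakNorm 𝕜 q (fun i => S (z i) (x i)) ≤ c * seqNorm ∞ x * weakNorm 𝕜 q z)
    {x : ℕ → X} {z : ℕ → Z} (hx : Memℓp x ∞) (hz : UnconditionallySummable 𝕜 q z) :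
    UnconditionallySummable 𝕜 q (fun i => S (z i) (x i)) := by
  refine ⟨weaklySummable_apply hq S (h x z) hx hz.1, ?_⟩
  have hz' := hz.2
  simp only [weakNorm_sub_truncation hq] at hz' ⊢
  have hB := ((memℓp_iff_seqNorm_lt_top le_top).1 hx).ne
  have hlim : Filter.Tendsto
      (fun N => c * seqNorm ∞ x * weakNorm 𝕜 q (fun i => z (N + i))) Filter.atTop (𝓝 0) := by
    simpa using ENNReal.Tendsto.const_mul hz' (.inr (ENNReal.mul_ne_top ENNReal.coe_ne_top hB))
  refine tendsto_of_tendsto_of_tendsto_of_le_of_le tendsto_const_nhds hlim (fun _ => zero_le)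
    fun N => (h _ _).trans ?_
  gcongr
  exact seqNorm_comp_le (add_right_injective N) x

/-- A null sequence of scalars maps `ℓ_q^w(Z)` into `ℓ_q^u(Z)`: the preceding result for the scalar
multiplication `Z → L(𝕜, Z)`. -/
lemma WeaklySummable.unconditionallySummable_smul (hq : 1 ≤ q) {z : ℕ → Z} {a : ℕ → 𝕜}
    (hz : WeaklySummable 𝕜 q z) (ha : Filter.Tendsto a Filter.atTop (𝓝 0)) :
    UnconditionallySummable 𝕜 q (fun i => a i • z i) := by
  refine unconditionallySummable_apply_of_tendsto_zero hq (c := 1)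
    (ContinuousLinearMap.lsmul 𝕜 𝕜 : 𝕜 →L[𝕜] Z →L[𝕜] Z).flip (fun b w => ?_) ha hz
  refine iSup₂_le fun φ hφ => ?_
  refine (seqNorm_le_mul_of_enorm_le (C := seqNorm ∞ b) hq (x := fun i => φ (w i))
    fun i => ?_).trans ?_
  · simp only [ContinuousLinearMap.flip_apply, ContinuousLinearMap.lsmul_apply, map_smul,
      enorm_smul]
    gcongr
    exact enorm_le_seqNorm le_top b i
  · rw [ENNReal.coe_one, one_mul]
    gcongr
    exact seqNorm_le_weakNorm w φ hφ

/-- A null sequence `(x_i)` is `(‖x_i‖ e_i)` with bounded `e_i`; moving the scalars `‖x_i‖` to the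
other factor turns a weakly summable `(z_i)` into an unconditionally summable one. -/
lemma weaklySummable_apply_of_unconditionallySummable (hq : 1 ≤ q) (S : Z →L[𝕜] X →L[𝕜] Y)
    (h : ∀ (x : ℕ → X) (z : ℕ → Z), Memℓp x ∞ → UnconditionallySummable 𝕜 q z →
      WeaklySummable 𝕜 q (fun i => S (z i) (x i)))
    {x : ℕ → X} {z : ℕ → Z} (hx : Filter.Tendsto x Filter.atTop (𝓝 0))
    (hz : WeaklySummable 𝕜 q z) :
    WeaklySummable 𝕜 q (fun i => S (z i) (x i)) := by
  choose e he hxe using fun i => exists_eq_norm_smul (𝕜 := 𝕜) (x i)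
  have ha : Filter.Tendsto (fun i => ((‖x i‖ : ℝ) : 𝕜)) Filter.atTop (𝓝 0) := by
    simpa [Function.comp_def] using (RCLike.continuous_ofReal (K := 𝕜)).continuousAt.tendsto.comp hx.norm
  have hmem : Memℓp e ∞ := by
    rw [memℓp_iff_seqNorm_lt_top le_top, seqNorm_top]
    exact (iSup_le he).trans_lt ENNReal.one_lt_top
  convert h e _ hmem (hz.unconditionallySummable_smul hq ha) using 2 with i
  conv_lhs => rw [hxe i]
  simp

end Operators

/-! ### Gluing finite systems -/

/-- The finite systems `(x_{k,j})_{j < n_k}`, `k ∈ ℕ`, arranged into one sequence: the vector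
`x_{k,j}` stands at the index `Nat.pair k j`, and all other terms are zero. -/
def glue {E : Type*} [Zero E] {n : ℕ → ℕ} (x : ∀ k, Fin (n k) → E) (i : ℕ) : E :=
  if h : i.unpair.2 < n i.unpair.1 then x i.unpair.1 ⟨i.unpair.2, h⟩ else 0

lemma glue_pair {E : Type*} [Zero E] {n : ℕ → ℕ} (x : ∀ k, Fin (n k) → E) (k j : ℕ) :
    glue x (Nat.pair k j) = if h : j < n k then x k ⟨j, h⟩ else 0 := by
  have key : ∀ m : ℕ × ℕ, m = (k, j) →
      (if h : m.2 < n m.1 then x m.1 ⟨m.2, h⟩ else 0) = if h : j < n k then x k ⟨j, h⟩ else 0 := by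
    rintro _ rfl
    rfl
  exact key _ (Nat.unpair_pair k j)

lemma tendsto_glue {E : Type*} [NormedAddCommGroup E] {n : ℕ → ℕ} (x : ∀ k, Fin (n k) → E)
    {r : ℕ → ℝ≥0∞} (hr : Filter.Tendsto r Filter.atTop (𝓝 0)) (h : ∀ k, seqNorm ∞ (x k) ≤ r k) :
    Filter.Tendsto (glue x) Filter.atTop (𝓝 0) := by
  rw [tendsto_zero_iff_enorm_tendsto_zero, ENNReal.tendsto_nhds_zero]
  intro ε hε
  obtain ⟨K, hK⟩ := Filter.eventually_atTop.1 (ENNReal.tendsto_nhds_zero.1 hr ε hε)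
  rw [← Nat.cofinite_eq_atTop, Filter.eventually_cofinite]
  refine ((Set.finite_Iio K).biUnion fun k _ =>
    Set.finite_range fun j : Fin (n k) => Nat.pair k j).subset fun i hi => ?_
  obtain ⟨k, j, rfl⟩ : ∃ k j, i = Nat.pair k j := ⟨_, _, (Nat.pair_unpair i).symm⟩
  rw [Set.mem_ofPred_eq, glue_pair] at hi
  split_ifs at hi with hj
  · refine Set.mem_biUnion (x := k) ?_ ⟨⟨j, hj⟩, rfl⟩
    by_contra hk
    exact hi (((enorm_le_seqNorm le_top (x k) ⟨j, hj⟩).trans (h k)).trans (hK k (not_lt.1 hk)))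
  · simp at hi

lemma seqNorm_glue_le {E : Type*} [NormedAddCommGroup E] {q : ℝ≥0∞} (hq : 1 ≤ q) {n : ℕ → ℕ}
    (x : ∀ k, Fin (n k) → E) (h : ∀ k, seqNorm q (x k) ≤ 2⁻¹ ^ k) : seqNorm q (glue x) ≤ 2 := by
  have h_one : ∀ k : ℕ, (2⁻¹ : ℝ≥0∞) ^ k ≤ 1 := fun k => pow_le_one₀ zero_le (by simp)
  rcases eq_or_ne q ∞ with rfl | hq'
  · rw [seqNorm_top]
    refine iSup_le fun i => ?_
    unfold glue
    split_ifs with hi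
    · exact ((enorm_le_seqNorm le_top _ _).trans (h _)).trans ((h_one _).trans one_le_two)
    · simp
  · have h0 := toReal_pos hq hq'
    have h1 : 1 ≤ q.toReal := by simpa using ENNReal.toReal_mono hq' hq
    have hk : ∀ k, ∑' j, ‖glue x (Nat.pair k j)‖ₑ ^ q.toReal ≤ 2⁻¹ ^ k := fun k => by
      rw [tsum_eq_sum (s := Finset.range (n k)), Finset.sum_range]
      · have := (seqNorm_le_iff_of_ne_top hq hq' _ _).1 (h k)
        rw [tsum_fintype] at this
        simp only [glue_pair, Fin.is_lt, dite_true]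
        exact this.trans (ENNReal.rpow_le_self_of_le_one (h_one k) h1)
      · intro j hj
        rw [glue_pair, dif_neg (by simpa using hj), enorm_zero, ENNReal.zero_rpow_of_pos h0]
    rw [seqNorm_le_iff_of_ne_top hq hq',
      ← Nat.pairEquiv.tsum_eq (fun i => ‖glue x i‖ₑ ^ q.toReal)]
    change ∑' m : ℕ × ℕ, ‖glue x (Nat.pair m.1 m.2)‖ₑ ^ q.toReal ≤ _
    rw [ENNReal.tsum_prod (f := fun k j => ‖glue x (Nat.pair k j)‖ₑ ^ q.toReal)]
    refine (ENNReal.tsum_le_tsum hk).trans ?_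
    rw [ENNReal.tsum_geometric, ENNReal.one_sub_inv_two, inv_inv]
    simpa using ENNReal.rpow_le_rpow_of_exponent_le one_le_two h1

section Gluing

variable {𝕜 X Y Z : Type*} [RCLike 𝕜] [NormedAddCommGroup X] [NormedSpace 𝕜 X]
  [NormedAddCommGroup Y] [NormedSpace 𝕜 Y] [NormedAddCommGroup Z] [NormedSpace 𝕜 Z]
  {q : ℝ≥0∞}

lemma weakNorm_glue_le (hq : 1 ≤ q) {n : ℕ → ℕ} (z : ∀ k, Fin (n k) → Z)
    (h : ∀ k, weakNorm 𝕜 q (z k) ≤ 2⁻¹ ^ k) : weakNorm 𝕜 q (glue z) ≤ 2 := by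
  refine iSup₂_le fun φ hφ => ?_
  have : (fun i => φ (glue z i)) = glue fun k j => φ (z k j) := by
    ext i
    unfold glue
    split_ifs <;> simp
  rw [this]
  exact seqNorm_glue_le hq _ fun k => (seqNorm_le_weakNorm (z k) φ hφ).trans (h k)

/-- A finite system violating the inequality with constant `t ^ 3` can be rescaled so that both
factors become small while the image stays large. -/
lemma exists_rescaled (hq : 1 ≤ q) (S : Z →L[𝕜] X →L[𝕜] Y) {t : ℝ≥0} (ht : 0 < t) {n : ℕ}
    {x : Fin n → X} {z : Fin n → Z}
    (h : (t ^ 3 : ℝ≥0) * seqNorm ∞ x * weakNorm 𝕜 q z < weakNorm 𝕜 q (fun i => S (z i) (x i))) :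
    ∃ (x' : Fin n → X) (z' : Fin n → Z), seqNorm ∞ x' ≤ (t : ℝ≥0∞)⁻¹ ∧
      weakNorm 𝕜 q z' ≤ (t : ℝ≥0∞)⁻¹ ∧ t ≤ weakNorm 𝕜 q (fun i => S (z' i) (x' i)) := by
  obtain ⟨a, ha⟩ := exists_coe_eq (seqNorm_lt_top (p := ∞) x).ne
  obtain ⟨b, hb⟩ := exists_coe_eq (weakNorm_lt_top_of_fin (𝕜 := 𝕜) (q := q) z).ne
  have hS0 : (∀ i, S (z i) (x i) = 0) → weakNorm 𝕜 q (fun i => S (z i) (x i)) = 0 := fun h0 => by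
    simp only [h0]
    simpa using weakNorm_smul_le hq (0 : 𝕜) (fun _ : Fin n => (0 : Y))
  have ha0 : a ≠ 0 := by
    rintro rfl
    have hx : ∀ i, x i = 0 := fun i => by
      simpa [← ha] using enorm_le_seqNorm le_top x i
    rw [hS0 (by simp [hx])] at h
    exact not_lt_zero h
  have hb0 : b ≠ 0 := by
    rintro rfl
    have hz : ∀ i, z i = 0 := fun i => by
      simpa [← hb] using enorm_le_weakNorm (𝕜 := 𝕜) hq z i
    rw [hS0 (by simp [hz])] at h
    exact not_lt_zero h
  have henorm : ∀ s : ℝ≥0, ‖((s : ℝ) : 𝕜)‖ₑ = s := fun s => by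
    rw [← ofReal_norm, RCLike.norm_ofReal, NNReal.abs_eq, ENNReal.ofReal_coe_nnreal]
  have hta : t * a ≠ 0 := mul_ne_zero ht.ne' ha0
  have htb : t * b ≠ 0 := mul_ne_zero ht.ne' hb0
  let α : ℝ≥0 := (t * a)⁻¹
  let β : ℝ≥0 := (t * b)⁻¹
  refine ⟨fun i => ((α : ℝ) : 𝕜) • x i, fun i => ((β : ℝ) : 𝕜) • z i, ?_, ?_, ?_⟩
  · refine (seqNorm_smul_le le_top _ x).trans ?_
    rw [henorm, ← ha, ← ENNReal.coe_inv ht.ne', ← ENNReal.coe_mul, ENNReal.coe_le_coe]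
    refine le_of_eq ?_
    simp only [α]
    field_simp
  · refine (weakNorm_smul_le hq _ z).trans ?_
    rw [henorm, ← hb, ← ENNReal.coe_inv ht.ne', ← ENNReal.coe_mul, ENNReal.coe_le_coe]
    refine le_of_eq ?_
    simp only [β]
    field_simp
  · -- Undo the scaling: the original image is `(t a) (t b)` times the rescaled one.
    let W := weakNorm 𝕜 q (fun i => S (((β : ℝ) : 𝕜) • z i) (((α : ℝ) : 𝕜) • x i))
    have h1 : weakNorm 𝕜 q (fun i => S (z i) (x i)) ≤ ((t * a * (t * b) : ℝ≥0) : ℝ≥0∞) * W := by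
      rw [← henorm]
      refine le_trans (le_of_eq ?_) (weakNorm_smul_le hq _ _)
      congr 1
      ext i
      have : (((t * a * (t * b) : ℝ≥0) : ℝ) : 𝕜) * ((β : ℝ) : 𝕜) * ((α : ℝ) : 𝕜) = 1 := by
        have h2 : t * a * (t * b) * β * α = 1 := by
          simp only [α, β]
          field_simp
        exact_mod_cast congrArg (fun r : ℝ≥0 => ((r : ℝ) : 𝕜)) h2
      have h3 : S (((β : ℝ) : 𝕜) • z i) (((α : ℝ) : 𝕜) • x i) =
          (((β : ℝ) : 𝕜) * ((α : ℝ) : 𝕜)) • S (z i) (x i) := by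
        rw [map_smul, map_smul, smul_apply, smul_smul, mul_comm]
      rw [h3, smul_smul, ← mul_assoc, this, one_smul]
    have h2 := h.trans_le h1
    rw [← ha, ← hb] at h2
    by_contra hW
    refine absurd h2 (not_lt.2 ?_)
    refine (mul_le_mul' le_rfl (not_le.1 hW).le).trans (le_of_eq ?_)
    norm_cast
    ring

/-- If `((S z_i) x_i)` is weakly summable whenever `(x_i)` is null and `(z_i)` is weakly summable,
then the inequality for finite systems holds: otherwise, finite systems violating it with constants
`8 ^ k` glue to sequences whose image has infinite weak norm. -/
lemma exists_forall_weakNorm_apply_le (hq : 1 ≤ q) (S : Z →L[𝕜] X →L[𝕜] Y)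
    (h : ∀ (x : ℕ → X) (z : ℕ → Z), Filter.Tendsto x Filter.atTop (𝓝 0) →
      WeaklySummable 𝕜 q z → WeaklySummable 𝕜 q (fun i => S (z i) (x i))) :
    ∃ c : ℝ≥0, 0 < c ∧ ∀ (n : ℕ) (x : Fin n → X) (z : Fin n → Z),
      weakNorm 𝕜 q (fun i => S (z i) (x i)) ≤ c * seqNorm ∞ x * weakNorm 𝕜 q z := by
  by_contra! hcon
  have hblock : ∀ k : ℕ, ∃ (n : ℕ) (x : Fin n → X) (z : Fin n → Z), seqNorm ∞ x ≤ 2⁻¹ ^ k ∧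
      weakNorm 𝕜 q z ≤ 2⁻¹ ^ k ∧ 2 ^ k ≤ weakNorm 𝕜 q (fun i => S (z i) (x i)) := fun k => by
    obtain ⟨n, x, z, hn⟩ := hcon ((2 ^ k) ^ 3) (by positivity)
    obtain ⟨x', z', h1, h2, h3⟩ := exists_rescaled hq S (t := 2 ^ k) (by positivity) hn
    refine ⟨n, x', z', ?_, ?_, ?_⟩
    · simpa [ENNReal.inv_pow] using h1
    · simpa [ENNReal.inv_pow] using h2
    · simpa using h3
  choose n x z hx hz hS using hblock
  have hlim : Filter.Tendsto (fun k : ℕ => (2⁻¹ : ℝ≥0∞) ^ k) Filter.atTop (𝓝 0) :=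
    ENNReal.tendsto_pow_atTop_nhds_zero_of_lt_one (by simp)
  have hfin := (h (glue x) (glue z) (tendsto_glue x hlim hx)
    (weaklySummable_of_weakNorm_lt_top hq
      ((weakNorm_glue_le hq z hz).trans_lt (by simp)))).weakNorm_lt_top hq
  obtain ⟨k, hk⟩ := ENNReal.exists_nat_gt hfin.ne
  have h1 : weakNorm 𝕜 q (fun i => S (z k i) (x k i)) ≤
      weakNorm 𝕜 q (fun i => S (glue z i) (glue x i)) := by
    have := weakNorm_comp_le (𝕜 := 𝕜) (q := q) (f := fun j : Fin (n k) => Nat.pair k j)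
      (fun i j hij => Fin.ext (Nat.pair_eq_pair.1 hij).2)
      (fun i => S (glue z i) (glue x i))
    simpa only [glue_pair, Fin.is_lt, dite_true] using this
  refine absurd hk (not_lt.2 (le_trans ?_ ((hS k).trans h1)))
  exact_mod_cast k.lt_two_pow_self.le

end Gluing
end ChevetSaphar

theorem theorem3p3 {𝕜 X Y Z : Type*} [RCLike 𝕜]
    [NormedAddCommGroup X] [NormedSpace 𝕜 X] [CompleteSpace X]
    [NormedAddCommGroup Y] [NormedSpace 𝕜 Y] [CompleteSpace Y]
    [NormedAddCommGroup Z] [NormedSpace 𝕜 Z] [CompleteSpace Z]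
    (p : ℝ≥0∞) [Fact (1 ≤ p)] (S : Z →L[𝕜] X →L[𝕜] Y) :
    List.TFAE [
      ∃ U : ChevetSaphar.CTensor 𝕜 Z X p →L[𝕜] Y, ChevetSaphar.associated U = S,
      ∃ c : ℝ≥0, 0 < c ∧ ∀ (n : ℕ) (x : Fin n → X) (z : Fin n → Z),
        ChevetSaphar.weakNorm 𝕜 p.conjExponent (fun i => S (z i) (x i)) ≤
          c * ChevetSaphar.seqNorm ∞ x * ChevetSaphar.weakNorm 𝕜 p.conjExponent z,
      ∃ c : ℝ≥0, 0 < c ∧ ∀ (x : ℕ → X) (z : ℕ → Z), Memℓp x ∞ →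
        ChevetSaphar.WeaklySummable 𝕜 p.conjExponent z → ∀ n : ℕ,
          ChevetSaphar.weakNorm 𝕜 p.conjExponent (fun i => S (z (n + i)) (x (n + i))) ≤
            c * ChevetSaphar.seqNorm ∞ (fun i => x (n + i)) *
              ChevetSaphar.weakNorm 𝕜 p.conjExponent (fun i => z (n + i)),
      ∀ (x : ℕ → X) (z : ℕ → Z), Memℓp x ∞ → ChevetSaphar.WeaklySummable 𝕜 p.conjExponent z →
        ChevetSaphar.WeaklySummable 𝕜 p.conjExponent (fun i => S (z i) (x i)),
      ∀ (x : ℕ → X) (z : ℕ → Z), Filter.Tendsto x Filter.atTop (𝓝 0) →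
        ChevetSaphar.WeaklySummable 𝕜 p.conjExponent z →
        ChevetSaphar.UnconditionallySummable 𝕜 p.conjExponent (fun i => S (z i) (x i)),
      ∀ (x : ℕ → X) (z : ℕ → Z), Memℓp x ∞ →
        ChevetSaphar.UnconditionallySummable 𝕜 p.conjExponent z →
        ChevetSaphar.UnconditionallySummable 𝕜 p.conjExponent (fun i => S (z i) (x i))] := by
  have hq := ChevetSaphar.one_le_conjExponent p
  tfae_have 1 → 2 := by
    rintro ⟨U, rfl⟩
    refine ⟨‖U‖₊ + 1, by positivity, fun n x z =>
      (ChevetSaphar.weakNorm_associated_le U x z).trans ?_⟩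
    gcongr
    rw [enorm_eq_nnnorm]
    exact_mod_cast le_self_add
  tfae_have 2 → 1 := fun ⟨c, hc, h⟩ => ChevetSaphar.exists_associated_eq S hc h
  tfae_have 2 → 3 := fun ⟨c, hc, h⟩ => ⟨c, hc, fun x z _ _ n =>
    ChevetSaphar.weakNorm_apply_le_of_fin hq S h _ _⟩
  tfae_have 3 → 4 := fun ⟨c, _, h⟩ x z hx hz =>
    ChevetSaphar.weaklySummable_apply hq S (by simpa using h x z hx hz 0) hx hz
  tfae_have 4 → 2 := fun h => ChevetSaphar.exists_forall_weakNorm_apply_le hq S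
    fun x z hx hz => h x z (ChevetSaphar.memℓp_top_of_tendsto_zero hx) hz
  tfae_have 2 → 5 := fun ⟨c, _, h⟩ x z hx hz =>
    ChevetSaphar.unconditionallySummable_apply_of_tendsto_zero hq S
      (ChevetSaphar.weakNorm_apply_le_of_fin hq S h) hx hz
  tfae_have 5 → 2 := fun h => ChevetSaphar.exists_forall_weakNorm_apply_le hq S
    fun x z hx hz => (h x z hx hz).1
  tfae_have 2 → 6 := fun ⟨c, _, h⟩ x z hx hz =>
    ChevetSaphar.unconditionallySummable_apply_of_memℓp hq S
      (ChevetSaphar.weakNorm_apply_le_of_fin hq S h) hx hz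
  tfae_have 6 → 2 := fun h => ChevetSaphar.exists_forall_weakNorm_apply_le hq S
    fun x z hx hz => ChevetSaphar.weaklySummable_apply_of_unconditionallySummable hq S
      (fun x z hx hz => (h x z hx hz).1) hx hz
  tfae_finish
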